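/- Let $n\ge 1$ and let $\mathrm{St}_n$ be the star graph on $n$ vertices, with root $r$ (the edges are exactly the pairs $\{r,v\}$ with $v\neq r$). A labeling is a bijection $L$ from the vertex set to $\{1,\dots,n\}$, a proper coloring is a map $\kappa$ from the vertex set to $\mathbb{Z}_{>0}$ with $\kappa(u)\ne\kappa(v)$ for adjacent $u,v$, $x^\kappa=\prod_v x_{\kappa(v)}$, and $\mathrm{asc}^L(\kappa)$ is the number of edges $\{u,v\}$ with $L(u)<L(v)$ and $\kappa(u)<\kappa(v)$. Consider the normalized total labeling chromatic quasisymmetric function $$\overline{T}\mathrm{st}_n(q)=\frac{1}{(n-1)!}\sum_{L}\sum_{\kappa}q^{\mathrm{asc}^L(\kappa)}x^\kappa ,$$ the sums being over all labelings $L$ and all proper colorings $\kappa$ of $\mathrm{St}_n$, and its expansion $\overline{T}\mathrm{st}_n(q)=\sum_{\alpha\models n}b_\alpha(q)M_\alpha$, with coefficients in $\mathbb{Q}[q]$, in the monomial quasisymmetric functions $M_\alpha=\sum_{j_1<\dots<j_\ell}x_{j_1}^{\alpha_1}\cdots x_{j_\ell}^{\alpha_\ell}$. For a composition $\alpha=(\alpha_1,\dots,\alpha_\ell)$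 of $n$ and $1\le i\le\ell$ put $\alpha^{<i}=(\alpha_1,\dots,\alpha_{i-1})$, $\alpha^{>i}=(\alpha_{i+1},\dots,\alpha_\ell)$, $L_{\alpha_i}=|\alpha^{<i}|$, $R_{\alpha_i}=|\alpha^{>i}|$, $s=s_i=\min\{R_{\alpha_i},L_{\alpha_i}\}$, where $|\beta|$ is the sum of the entries of $\beta$; let $\mathrm{mult}(\beta)=|\beta|!/\prod_j\beta_j!$ (equal to $1$ for the empty composition), and $[m]_q=1+q+\dots+q^{m-1}$. Then the expansion exists, is unique, and for every composition $\alpha$ of $n$ $$b_\alpha(q)=\sum_{i:\,\alpha_i=1}\mathrm{mult}(\alpha^{>i})\,\mathrm{mult}(\alpha^{<i})\sum_{l=0}^{s_i}\binom{n}{l}q^l[n-2l]_q .$$ Moreover, for each $1\le p\le n$ choose any labeling $L_p$ with $L_p(r)=p$, and for $i$ with $\alpha_i=1$ let $$b_\alpha(i;q)=\sum_{p=1}^n\sum_{\kappa}q^{\mathrm{asc}^{L_p}(\kappa)},$$ where $\kappa$ runs over the proper colorings of $\mathrm{St}_n$ with exactly $\alpha_c$ vertices of color $c$ for $1\le c\le\ell$,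 no other colors, and $\kappa(r)=i$. Then for all $0\le k\le n-1$ $$[q^k]\,b_\alpha(i;q)=\mathrm{mult}(\alpha^{>i})\,\mathrm{mult}(\alpha^{<i})\sum_{l=0}^{\min\{k,\,n-1-k,\,s_i\}}\binom{n}{l}.$$ In particular the upper summation limit is $\min\{k,s_i\}$ when $k\le\lfloor (n-1)/2\rfloor$. -/

import Mathlib

open Polynomial

noncomputable section

namespace StarCQSF

/-- The formal sum `∑ₖ wₖ x^(eₖ)` of a family of weighted monomials: the coefficient of `x^m` is the
sum of the weights `wₖ` over all `k` with `eₖ = m`. It is used below only for families with finitely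
many members of each exponent (`finite_coloring_fiber`, `finite_orderEmb_fiber`). -/
def formalSum {ι σ R : Type*} [CommSemiring R] (w : ι → R) (e : ι → σ →₀ ℕ) : MvPowerSeries σ R :=
  fun m => ∑ᶠ (k : ι) (_ : e k = m), w k

/-! ### Compositions and monomial quasisymmetric functions -/

/-- The exponent of the monomial `x_{j 1}^{α 1} ⋯ x_{j ℓ}^{α ℓ}`. -/
def monoExp {n : ℕ} (α : Composition n) (j : Fin α.length → ℕ+) : ℕ+ →₀ ℕ :=
  ∑ i, Finsupp.single (j i) (α.blocksFun i)

/-- The monomial quasisymmetric function `M_α = ∑_{j 1 < ⋯ < j ℓ} x_{j 1}^{α 1} ⋯ x_{j ℓ}^{α ℓ}` in the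
variables `x₁, x₂, …`, over `ℚ[q]`. -/
def monomialQSym {n : ℕ} (α : Composition n) : MvPowerSeries ℕ+ ℚ[X] :=
  formalSum (fun _ : Fin α.length ↪o ℕ+ => 1) (fun j => monoExp α j)

/-- The multinomial coefficient of the entries of `α` strictly to the left of position `i`. -/
def multLeft {n : ℕ} (α : Composition n) (i : Fin α.length) : ℕ :=
  Nat.multinomial (Finset.Iio i) α.blocksFun

/-- The multinomial coefficient of the entries of `α` strictly to the right of position `i`. -/
def multRight {n : ℕ} (α : Composition n) (i : Fin α.length) : ℕ :=
  Nat.multinomial (Finset.Ioi i) α.blocksFun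

/-- The sum of the entries of `α` strictly to the left of position `i`. -/
def sizeLeft {n : ℕ} (α : Composition n) (i : Fin α.length) : ℕ :=
  ∑ j ∈ Finset.Iio i, α.blocksFun j

/-- The sum of the entries of `α` strictly to the right of position `i`. -/
def sizeRight {n : ℕ} (α : Composition n) (i : Fin α.length) : ℕ :=
  ∑ j ∈ Finset.Ioi i, α.blocksFun j

/-- The `q`-analogue `[m]_q = 1 + q + ⋯ + q^(m-1)`. -/
def qInt (m : ℕ) : ℚ[X] := ∑ j ∈ Finset.range m, X ^ j

/-! ### Labelings, colorings and chromatic quasisymmetric functions -/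

variable {V : Type*} [Fintype V]

/-- A labeling of the vertices. The label set `{1, …, |V|}` is represented by `Fin |V|`, the label
`k` being `k - 1`; only the order of the labels matters. -/
abbrev Labeling (V : Type*) [Fintype V] := V ≃ Fin (Fintype.card V)

/-- The exponent of `x^κ = ∏ᵥ x_{κ v}`. -/
def content {G : SimpleGraph V} (κ : G.Coloring ℕ+) : ℕ+ →₀ ℕ :=
  ∑ v, Finsupp.single (κ v) 1

open Classical in
/-- The exponent of `x_c` in `x^κ` is the number of vertices of color `c`. -/
theorem content_apply {G : SimpleGraph V} (κ : G.Coloring ℕ+) (c : ℕ+) :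
    content κ c = (Finset.univ.filter fun v => κ v = c).card := by
  simp [content, Finsupp.finsetSum_apply, Finsupp.single_apply]

open Classical in
/-- The number of ascents: edges `{u, v}` with `L u < L v` and `κ u < κ v`. Each edge is listed once,
as the ordered pair in which the end with the smaller label comes first. -/
def asc {G : SimpleGraph V} (L : Labeling V) (κ : G.Coloring ℕ+) : ℕ :=
  (Finset.univ.filter fun p : V × V => G.Adj p.1 p.2 ∧ L p.1 < L p.2 ∧ κ p.1 < κ p.2).card

/-- The chromatic quasisymmetric function `∑_κ q^(asc κ) x^κ`, over all proper colorings `κ` of `G`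
with positive integers. -/
def cqsf (G : SimpleGraph V) (L : Labeling V) : MvPowerSeries ℕ+ ℚ[X] :=
  formalSum (fun κ : G.Coloring ℕ+ => X ^ asc L κ) content

open Classical in
/-- The total labeling chromatic quasisymmetric function. -/
def totalCqsf (G : SimpleGraph V) : MvPowerSeries ℕ+ ℚ[X] :=
  ∑ L : Labeling V, cqsf G L

/-- The normalized total labeling chromatic quasisymmetric function of the star graph on the vertex
set `V` with root `r`. -/
def normalizedStar (r : V) : MvPowerSeries ℕ+ ℚ[X] :=
  ((Nat.factorial (Fintype.card V - 1) : ℚ)⁻¹) • totalCqsf (SimpleGraph.starGraph r)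

/-- The proper colorings of the star graph that use exactly the colors `1, …, ℓ(α)`, the color `c`
exactly `α_c` times, and that give the root the color `i`. Positions in `α` are numbered from `0`
in `Fin`, so that position `i` corresponds to the color `i + 1`. -/
def rootColorings {n : ℕ} (r : V) (α : Composition n) (i : Fin α.length) :
    Set ((SimpleGraph.starGraph r).Coloring ℕ+) :=
  {κ | content κ = monoExp α (fun j => Nat.succPNat j) ∧ κ r = Nat.succPNat i}

/-- The polynomial `b_α(i; q) = ∑_k ∑_κ q^(asc κ)`: the outer sum is over the possible labels `k` of
the root, the inner one over `rootColorings r α i`, and ascents are taken with respect to a chosen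
labeling `Lr k`, meant to be one that gives the root the label `k`. -/
def rootCoeff {n : ℕ} (r : V) (Lr : Fin (Fintype.card V) → Labeling V) (α : Composition n)
    (i : Fin α.length) : ℚ[X] :=
  ∑ k, ∑ᶠ κ ∈ rootColorings r α i, X ^ asc (Lr k) κ

/-! ### The formal sums above have finite fibers -/

theorem finite_coloring_fiber (G : SimpleGraph V) (m : ℕ+ →₀ ℕ) :
    {κ : G.Coloring ℕ+ | content κ = m}.Finite := by
  have h : (Set.pi Set.univ fun _ : V => (m.support : Set ℕ+)).Finite :=
    Set.Finite.pi fun _ => m.support.finite_toSet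
  refine Set.Finite.subset (h.preimage (f := fun κ : G.Coloring ℕ+ => (κ : V → ℕ+))
    (DFunLike.coe_injective.injOn)) ?_
  rintro κ rfl v -
  classical
  simp only [Finset.mem_coe, Finsupp.mem_support_iff, content_apply, ne_eq, Finset.card_eq_zero]
  exact Finset.ne_empty_of_mem (a := v) (by simp)

theorem finite_orderEmb_fiber {n : ℕ} (α : Composition n) (m : ℕ+ →₀ ℕ) :
    {j : Fin α.length ↪o ℕ+ | monoExp α j = m}.Finite := by
  have h : (Set.pi Set.univ fun _ : Fin α.length => (m.support : Set ℕ+)).Finite :=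
    Set.Finite.pi fun _ => m.support.finite_toSet
  refine Set.Finite.subset (h.preimage (f := fun j : Fin α.length ↪o ℕ+ => (j : Fin α.length → ℕ+))
    (DFunLike.coe_injective.injOn)) ?_
  rintro j rfl i -
  simp only [Finset.mem_coe, Finsupp.mem_support_iff, monoExp, Finsupp.finsetSum_apply]
  have h1 := α.one_le_blocksFun i
  have h2 := Finset.single_le_sum (f := fun k => Finsupp.single (j k) (α.blocksFun k) (j i))
    (fun _ _ => Nat.zero_le _) (Finset.mem_univ i)
  simp only [Finsupp.single_eq_same] at h2
  omega

end StarCQSF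

end

open Polynomial

noncomputable section

namespace StarCQSF

/-! Every edge contains the root, so the root's color occurs exactly once: only positions `i` with
`α_i = 1` contribute. Fix such an `i` and a labeling giving `p` leaves a label smaller than the
root's. An edge to one of them is an ascent iff the leaf is colored below `i`; for each of the other
`m` leaves, iff it is colored above. Ascents therefore depend only on the side of `i` on which each
leaf's color lies. If `X` marks the leaves colored below, their generating function is `(1 + qX)^p
(q + X)^m`, and distributing colors within the two sides contributes the two multinomial
coefficients (`finsum_positionMaps`).

Each root label occurs in `(n-1)!` labelings, which cancels the normalization. It remains to expand
`starGF N = ∑_p (1 + qX)^p (q + X)^(N-p)` with `N = n - 1`. The recursion `starGF_succ` and Pascal's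
rule for partial row sums show that the coefficient of `X^a q^k` is `∑ binom (N+1) l` over `l < min
{k+1, N+1-k, a+1, N+1-a}` (`coeff_coeff_starGF`). This is the formula for `b_α(i; q)`; regrouping by
`l` gives the `q`-integers.

Existence and uniqueness of the expansion hold because each monomial of degree `n` occurs in exactly
one `M_α`, with coefficient one. -/

/-! ### The generating function of the star graph -/

/-- The partial row sum `∑_{l < m} binom N l`. -/
def chooseSum (N m : ℕ) : ℕ := ∑ l ∈ Finset.range m, N.choose l

theorem chooseSum_succ_left (N m : ℕ) :
    chooseSum (N + 1) m = chooseSum N m + chooseSum N (m - 1) := by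
  induction m with
  | zero => simp [chooseSum]
  | succ m ih =>
    cases m with
    | zero => simp [chooseSum]
    | succ m =>
      simp only [chooseSum, Finset.sum_range_succ, Nat.choose_succ_succ, Nat.succ_eq_add_one,
        Nat.add_sub_cancel] at ih ⊢
      omega

/-- The number of terms of the row sum that gives the coefficients of `starGF`. -/
def starBound (N a k : ℕ) : ℕ := min (min (k + 1) (N + 1 - k)) (min (a + 1) (N + 1 - a))

/-- Off the diagonal `k = a`, the two bounds on the right are, in some order, the bound on the left
and its predecessor, so this is Pascal's rule. On the diagonal both equal the predecessor, and the
missing last binomial is the extra term. -/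
theorem chooseSum_starBound_succ (N a k : ℕ) :
    chooseSum (N + 2) (starBound (N + 1) a k) =
      chooseSum (N + 1) (min (min (k + 1) (N + 1 - k)) (min a (N + 2 - a))) +
      chooseSum (N + 1) (min (min k (N + 2 - k)) (min (a + 1) (N + 1 - a))) +
      if k = a then (N + 1).choose a else 0 := by
  rw [chooseSum_succ_left, starBound]
  rcases lt_trichotomy k a with h | h | h
  · rw [if_neg h.ne, add_zero]
    congr 2 <;> omega
  · subst h
    rw [if_pos rfl]
    -- For `k > N + 1` truncated subtraction makes all the bounds zero.
    rcases Nat.lt_or_ge (N + 1) k with hk | hk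
    · rw [Nat.choose_eq_zero_of_lt hk, add_zero]
      congr 2 <;> omega
    · have h1 : min (min (k + 1) (N + 1 + 1 - k)) (min (k + 1) (N + 1 + 1 - k)) =
          min k (N + 1 - k) + 1 := by omega
      have h2 : min (min (k + 1) (N + 1 - k)) (min k (N + 2 - k)) = min k (N + 1 - k) := by omega
      have h3 : min (min k (N + 2 - k)) (min (k + 1) (N + 1 - k)) = min k (N + 1 - k) := by omega
      have h4 : (N + 1).choose (min k (N + 1 - k)) = (N + 1).choose k := by
        rcases min_choice k (N + 1 - k) with h | h <;> rw [h]
        exact Nat.choose_symm hk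
      rw [h1, h2, h3, Nat.add_sub_cancel, ← h4]
      simp only [chooseSum, Finset.sum_range_succ]
      omega
  · rw [if_neg h.ne', add_zero, add_comm]
    congr 2 <;> omega

/-- The polynomial `(1 + qX)^p (q + X)^m`. The coefficient of `X^a` is the generating function, by
ascents, of the sets of `a` leaves coloured below a root that has `p` leaves with smaller and `m`
leaves with larger label. -/
def rootGF (p m : ℕ) : ℚ[X][X] := (1 + C X * X) ^ p * (C X + X) ^ m

/-- The sum of `rootGF` over all labels of the root. -/
def starGF (N : ℕ) : ℚ[X][X] := ∑ p ∈ Finset.range (N + 1), rootGF p (N - p)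

/-- The factor `q + X` is a new leaf of larger label; the summand not obtained this way is the one
where the root has the largest label. -/
theorem starGF_succ (N : ℕ) :
    starGF (N + 1) = (C X + X) * starGF N + (1 + C X * X) ^ (N + 1) := by
  rw [starGF, Finset.sum_range_succ, starGF, Finset.mul_sum]
  refine congrArg₂ _ (Finset.sum_congr rfl fun p hp => ?_) ?_
  · rw [Finset.mem_range] at hp
    rw [rootGF, rootGF, show N + 1 - p = N - p + 1 by omega]
    ring
  · simp [rootGF]

theorem coeff_one_add_C_mul_X_pow (m a : ℕ) :
    ((1 + C X * X : ℚ[X][X]) ^ m).coeff a = (m.choose a : ℚ[X]) * X ^ a := by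
  have h : (1 + C X * X : ℚ[X][X]) ^ m = ((1 + X) ^ m : ℚ[X][X]).comp (C X * X) := by simp
  rw [h, comp_C_mul_X_coeff, coeff_one_add_X_pow]

theorem coeff_coeff_one_add_C_mul_X_pow (m a k : ℕ) :
    (((1 + C X * X : ℚ[X][X]) ^ m).coeff a).coeff k = if k = a then (m.choose a : ℚ) else 0 := by
  rw [coeff_one_add_C_mul_X_pow, coeff_natCast_mul, coeff_X_pow]
  split_ifs <;> simp

theorem coeff_coeff_starGF (N a k : ℕ) :
    ((starGF N).coeff a).coeff k = (chooseSum (N + 1) (starBound N a k) : ℚ) := by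
  induction N generalizing a k with
  | zero =>
    have h : starGF 0 = 1 := by simp [starGF, rootGF]
    rw [h, coeff_one]
    rcases Nat.eq_zero_or_pos a with rfl | ha
    · rw [if_pos rfl, coeff_one]
      rcases Nat.eq_zero_or_pos k with rfl | hk
      · simp [chooseSum, starBound]
      · rw [if_neg hk.ne', show starBound 0 0 k = 0 by unfold starBound; omega]
        simp [chooseSum]
    · rw [if_neg ha.ne', show starBound 0 a k = 0 by unfold starBound; omega]
      simp [chooseSum]
  | succ N ih =>
    rw [chooseSum_starBound_succ, starGF_succ, coeff_add, coeff_add,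
      coeff_coeff_one_add_C_mul_X_pow, add_mul, coeff_add, coeff_C_mul, coeff_add, add_comm (coeff _ k)]
    push_cast
    congr 2
    · cases a with
      | zero => simp [chooseSum]
      | succ a =>
        rw [coeff_X_mul, ih, starBound, show N + 2 - (a + 1) = N + 1 - a by omega]
    · cases k with
      | zero => simp [chooseSum]
      | succ k =>
        rw [coeff_X_mul, ih, starBound, show N + 2 - (k + 1) = N + 1 - k by omega]

theorem coeff_qInt (m k : ℕ) : (qInt m).coeff k = if k < m then 1 else 0 := by
  simp [qInt, finsetSum_coeff, coeff_X_pow]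

theorem coeff_starGF (N a b : ℕ) (h : a + b = N) :
    (starGF N).coeff a = ∑ l ∈ Finset.range (min b a + 1),
      (Nat.choose (N + 1) l : ℚ[X]) * X ^ l * qInt (N + 1 - 2 * l) := by
  ext k
  rw [coeff_coeff_starGF, chooseSum, finsetSum_coeff]
  push_cast
  -- The term `q^l [N+1-2l]_q` contains `q^k` exactly when `l ≤ k < N + 1 - l`.
  have h1 : ∀ l ∈ Finset.range (min b a + 1),
      ((Nat.choose (N + 1) l : ℚ[X]) * X ^ l * qInt (N + 1 - 2 * l)).coeff k =
        if l < min (k + 1) (N + 1 - k) then (Nat.choose (N + 1) l : ℚ) else 0 := by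
    intro l hl
    rw [Finset.mem_range] at hl
    rw [mul_assoc, coeff_natCast_mul, coeff_X_pow_mul', coeff_qInt]
    split_ifs <;> first | omega | simp
  rw [Finset.sum_congr rfl h1, ← Finset.sum_filter]
  refine Finset.sum_congr ?_ fun _ _ => rfl
  ext l
  simp only [Finset.mem_range, Finset.mem_filter, starBound]
  omega

/-! ### Multinomial coefficients and products of linear forms -/

/-- Homogenization: setting `y = 1` loses nothing, since the number of factors fixes the total
degree. It is applied with `x` and `y` the sums of the variables below and above the root's
position. -/
theorem prod_linear_eq_sum {U R A : Type*} [CommSemiring R] [CommSemiring A] [Algebra R A]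
    (s : Finset U) (u v : U → R) (x y : A) :
    ∏ i ∈ s, (algebraMap R A (u i) * x + algebraMap R A (v i) * y) =
      ∑ a ∈ Finset.range (s.card + 1),
        algebraMap R A ((∏ i ∈ s, (C (u i) * X + C (v i))).coeff a) *
          (x ^ a * y ^ (s.card - a)) := by
  classical
  have h : ∀ a, (∏ i ∈ s, (C (u i) * X + C (v i))).coeff a =
      ∑ t ∈ s.powersetCard a, (∏ i ∈ t, u i) * ∏ i ∈ s \ t, v i := by
    intro a
    rw [Finset.prod_add, finsetSum_coeff]
    have h1 : ∀ t ∈ s.powerset,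
        ((∏ i ∈ t, (C (u i) * X)) * ∏ i ∈ s \ t, C (v i) : R[X]).coeff a =
          if t.card = a then (∏ i ∈ t, u i) * ∏ i ∈ s \ t, v i else 0 := by
      intro t _
      rw [Finset.prod_mul_distrib, Finset.prod_const, ← map_prod, ← map_prod, mul_right_comm,
        ← C_mul, coeff_C_mul, coeff_X_pow]
      simp only [eq_comm, mul_ite, mul_one, mul_zero]
    rw [Finset.sum_congr rfl h1, ← Finset.sum_filter, Finset.powersetCard_eq_filter]
  rw [Finset.prod_add, Finset.sum_powerset]
  refine Finset.sum_congr rfl fun a _ => ?_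
  rw [h, map_sum, Finset.sum_mul]
  refine Finset.sum_congr rfl fun t ht => ?_
  rw [Finset.mem_powersetCard] at ht
  rw [Finset.prod_mul_distrib, Finset.prod_mul_distrib, Finset.prod_const, Finset.prod_const,
    Finset.card_sdiff_of_subset ht.1, ht.2, map_mul, map_prod, map_prod]
  ring

/-- By the multinomial theorem twice: as `s`, `t` and `{i}` are disjoint, the only pair of exponents
producing `m` consists of its restrictions to `s` and `t`. -/
theorem coeff_sum_X_pow_mul {σ R : Type*} [DecidableEq σ] [CommSemiring R] (s t : Finset σ) (i : σ)
    (hs : i ∉ s) (ht : i ∉ t) (hst : Disjoint s t) (m : σ →₀ ℕ) (hi : m i = 1)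
    (hm : ∀ c, c ≠ i → c ∉ s → c ∉ t → m c = 0) (a b : ℕ) :
    MvPolynomial.coeff m ((MvPolynomial.X i : MvPolynomial σ R) *
      ((∑ c ∈ s, MvPolynomial.X c) ^ a * (∑ c ∈ t, MvPolynomial.X c) ^ b)) =
      if ∑ c ∈ s, m c = a ∧ ∑ c ∈ t, m c = b then
        ((Nat.multinomial t m * Nat.multinomial s m : ℕ) : R) else 0 := by
  classical
  have hmon : ∀ (s : Finset σ) (f : σ → ℕ), ∏ c ∈ s, (MvPolynomial.X c : MvPolynomial σ R) ^ f c =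
      MvPolynomial.monomial (∑ c ∈ s, Finsupp.single c (f c)) 1 := by
    intro s f
    rw [MvPolynomial.monomial_sum_one]
    exact Finset.prod_congr rfl fun c _ => MvPolynomial.X_pow_eq_monomial
  have hval : ∀ (s : Finset σ) (f : σ → ℕ) (d : σ), (∑ c ∈ s, Finsupp.single c (f c)) d =
      if d ∈ s then f d else 0 := by
    intro s f d
    simp [Finsupp.finsetSum_apply, Finsupp.single_apply]
  rw [Finset.sum_pow_eq_sum_piAntidiag, Finset.sum_pow_eq_sum_piAntidiag, Finset.sum_mul_sum,
    Finset.mul_sum, MvPolynomial.coeff_sum]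
  have hterm : ∀ f ∈ s.piAntidiag a, ∀ g ∈ t.piAntidiag b,
      MvPolynomial.coeff m ((MvPolynomial.X i : MvPolynomial σ R) *
        (((Nat.multinomial s f : MvPolynomial σ R) * ∏ c ∈ s, MvPolynomial.X c ^ f c) *
        ((Nat.multinomial t g : MvPolynomial σ R) * ∏ c ∈ t, MvPolynomial.X c ^ g c))) =
      if f = (fun c => if c ∈ s then m c else 0) ∧ g = (fun c => if c ∈ t then m c else 0) then
        ((Nat.multinomial t m * Nat.multinomial s m : ℕ) : R) else 0 := by
    intro f hf g hg
    rw [Finset.mem_piAntidiag] at hf hg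
    have e : (MvPolynomial.X i : MvPolynomial σ R) *
        (((Nat.multinomial s f : MvPolynomial σ R) * ∏ c ∈ s, MvPolynomial.X c ^ f c) *
        ((Nat.multinomial t g : MvPolynomial σ R) * ∏ c ∈ t, MvPolynomial.X c ^ g c)) =
        MvPolynomial.C ((Nat.multinomial t g * Nat.multinomial s f : ℕ) : R) *
        MvPolynomial.monomial (Finsupp.single i 1 + (∑ c ∈ s, Finsupp.single c (f c) +
          ∑ c ∈ t, Finsupp.single c (g c))) 1 := by
      have h1 : ∀ d d' : σ →₀ ℕ, MvPolynomial.monomial (d + d') (1 : R) =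
          MvPolynomial.monomial d 1 * MvPolynomial.monomial d' 1 := by
        simp [MvPolynomial.monomial_mul]
      rw [hmon, hmon, h1, h1, MvPolynomial.X]
      push_cast
      simp only [map_mul, map_natCast]
      ring
    rw [e, MvPolynomial.coeff_C_mul, MvPolynomial.coeff_monomial, mul_ite, mul_one, mul_zero]
    have hiff : Finsupp.single i 1 + (∑ c ∈ s, Finsupp.single c (f c) +
          ∑ c ∈ t, Finsupp.single c (g c)) = m ↔
        f = (fun c => if c ∈ s then m c else 0) ∧ g = (fun c => if c ∈ t then m c else 0) := by
      constructor
      · intro h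
        have hd : ∀ d, _ := fun d => DFunLike.congr_fun h d
        simp only [Finsupp.add_apply, hval, Finsupp.single_apply] at hd
        refine ⟨funext fun c => ?_, funext fun c => ?_⟩
        · split_ifs with hc
          · have := hd c
            rw [if_neg (ne_of_mem_of_not_mem hc hs).symm, if_pos hc,
              if_neg (Finset.disjoint_left.1 hst hc)] at this
            omega
          · by_contra h0
            exact hc (hf.2 c h0)
        · split_ifs with hc
          · have := hd c
            rw [if_neg (ne_of_mem_of_not_mem hc ht).symm, if_pos hc,
              if_neg (Finset.disjoint_right.1 hst hc)] at this
            omega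
          · by_contra h0
            exact hc (hg.2 c h0)
      · rintro ⟨rfl, rfl⟩
        ext d
        simp only [Finsupp.add_apply, hval, Finsupp.single_apply]
        by_cases h1 : i = d
        · subst h1
          simp [hs, ht, hi]
        · by_cases h2 : d ∈ s
          · simp [h1, h2, Finset.disjoint_left.1 hst h2]
          · by_cases h3 : d ∈ t
            · simp [h1, h2, h3]
            · simp [h1, h2, h3, hm d (Ne.symm h1) h2 h3]
    rw [if_congr hiff rfl rfl]
    refine ite_congr rfl (fun h => ?_) fun _ => rfl
    rw [h.1, h.2]
    congr 2 <;> exact Nat.multinomial_congr fun c hc => by simp [hc]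
  have hsum : ∀ s : Finset σ, ∑ c ∈ s, (if c ∈ s then m c else 0) = ∑ c ∈ s, m c :=
    fun s => Finset.sum_congr rfl fun c hc => if_pos hc
  have hmem : ∀ (s : Finset σ) (a : ℕ), (fun c => if c ∈ s then m c else 0) ∈ s.piAntidiag a ↔
      ∑ c ∈ s, m c = a := by
    intro s a
    rw [Finset.mem_piAntidiag, hsum]
    exact and_iff_left fun c hc => by by_contra h; simp [h] at hc
  have hrow : ∀ f ∈ s.piAntidiag a,
      MvPolynomial.coeff m ((MvPolynomial.X i : MvPolynomial σ R) * ∑ g ∈ t.piAntidiag b,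
        (((Nat.multinomial s f : MvPolynomial σ R) * ∏ c ∈ s, MvPolynomial.X c ^ f c) *
        ((Nat.multinomial t g : MvPolynomial σ R) * ∏ c ∈ t, MvPolynomial.X c ^ g c))) =
      if f = (fun c => if c ∈ s then m c else 0) then (if ∑ c ∈ t, m c = b then
        ((Nat.multinomial t m * Nat.multinomial s m : ℕ) : R) else 0) else 0 := by
    intro f hf
    rw [Finset.mul_sum, MvPolynomial.coeff_sum, Finset.sum_congr rfl (hterm f hf)]
    simp only [ite_and]
    split_ifs with h1 h2
    · rw [Finset.sum_ite_eq', if_pos ((hmem t b).2 h2)]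
    · rw [Finset.sum_ite_eq', if_neg (mt (hmem t b).1 h2)]
    · exact Finset.sum_const_zero
  rw [Finset.sum_congr rfl hrow, Finset.sum_ite_eq', ite_and]
  exact if_congr (hmem s a) rfl rfl

/-! ### Compositions and exponents -/

theorem monoExp_apply {n : ℕ} (α : Composition n) (j : Fin α.length ↪o ℕ+) (i : Fin α.length) :
    monoExp α j (j i) = α.blocksFun i := by
  simp [monoExp, Finsupp.finsetSum_apply, Finsupp.single_apply]

theorem support_monoExp {n : ℕ} (α : Composition n) (j : Fin α.length ↪o ℕ+) :
    ((monoExp α j).support : Set ℕ+) = Set.range j := by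
  ext c
  simp only [Finset.mem_coe, Finsupp.mem_support_iff, Set.mem_range]
  constructor
  · intro h
    by_contra! hc
    refine h ?_
    rw [monoExp, Finsupp.finsetSum_apply]
    exact Finset.sum_eq_zero fun i _ => Finsupp.single_eq_of_ne' (hc i)
  · rintro ⟨i, rfl⟩
    rw [monoExp_apply]
    have := α.one_le_blocksFun i
    omega

theorem degree_monoExp {n : ℕ} (α : Composition n) (j : Fin α.length → ℕ+) :
    (monoExp α j).degree = n := by
  rw [monoExp, map_sum]
  simp [Finsupp.degree_single]

theorem degree_content {V : Type*} [Fintype V] {G : SimpleGraph V} (κ : G.Coloring ℕ+) :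
    (content κ).degree = Fintype.card V := by
  rw [content, map_sum]
  simp [Finsupp.degree_single]

theorem monoExp_injective {n : ℕ} (α : Composition n) :
    Function.Injective fun j : Fin α.length ↪o ℕ+ => monoExp α j := by
  intro j j' h
  rw [← OrderEmbedding.range_inj, ← support_monoExp, ← support_monoExp]
  exact congrArg (fun m : ℕ+ →₀ ℕ => (m.support : Set ℕ+)) h

/-- A monomial determines its composition: read its nonzero exponents in increasing order of the
variables. -/
theorem blocks_eq_map_sort {n : ℕ} (α : Composition n) (j : Fin α.length ↪o ℕ+) :
    α.blocks = ((monoExp α j).support.sort (· ≤ ·)).map (monoExp α j) := by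
  classical
  have h1 : (monoExp α j).support = (List.ofFn j).toFinset := by
    rw [← Finset.coe_inj, support_monoExp]
    ext c
    simp [List.mem_ofFn]
  have h2 : (monoExp α j).support.sort (· ≤ ·) = List.ofFn j := by
    rw [h1, List.toFinset_sort _ (List.nodup_ofFn.2 j.injective), List.pairwise_ofFn]
    exact fun a b h => j.monotone h.le
  rw [h2, List.map_ofFn, ← Composition.ofFn_blocksFun]
  congr 1
  ext i
  exact (monoExp_apply α j i).symm

theorem eq_of_monoExp_eq {n : ℕ} {α β : Composition n} (j : Fin α.length ↪o ℕ+)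
    (j' : Fin β.length ↪o ℕ+) (h : monoExp α j = monoExp β j') : α = β := by
  apply Composition.ext
  rw [blocks_eq_map_sort α j, blocks_eq_map_sort β j', h]

theorem exists_monoExp_eq {n : ℕ} (m : ℕ+ →₀ ℕ) (hm : m.degree = n) :
    ∃ (α : Composition n) (j : Fin α.length ↪o ℕ+), monoExp α j = m := by
  let e := m.support.orderEmbOfFin rfl
  have hsum : ∑ i, m (e i) = n := by
    rw [← hm, Finsupp.degree_apply, ← Finset.sum_coe_sort m.support]
    exact (m.support.orderIsoOfFin rfl).toEquiv.sum_comp fun c => m c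
  let α : Composition n :=
    { blocks := List.ofFn fun i => m (e i)
      blocks_pos := by
        intro i hi
        obtain ⟨k, rfl⟩ := List.mem_ofFn.1 hi
        exact Nat.pos_of_ne_zero (Finsupp.mem_support_iff.1 (Finset.orderEmbOfFin_mem _ _ k))
      blocks_sum := by rw [List.sum_ofFn, hsum] }
  have hl : α.length = m.support.card := List.length_ofFn
  refine ⟨α, (Fin.castOrderIso hl).toOrderEmbedding.trans e, ?_⟩
  have hb : ∀ i, α.blocksFun i = m (e (Fin.cast hl i)) := by
    intro i
    simp only [Composition.blocksFun, α, List.get_ofFn]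
  have hm' : ∑ i, Finsupp.single (e i) (m (e i)) = m := by
    conv_rhs => rw [← Finsupp.sum_single m, Finsupp.sum, ← Finset.sum_coe_sort]
    exact (m.support.orderIsoOfFin rfl).toEquiv.sum_comp
      fun c => Finsupp.single (c : ℕ+) (m c)
  rw [monoExp]
  refine Eq.trans ?_ hm'
  rw [← (Fin.castOrderIso hl).toEquiv.sum_comp]
  refine Finset.sum_congr rfl fun i _ => ?_
  rw [hb]
  rfl

/-! ### Coefficients in the monomial quasisymmetric basis. -/

theorem coeff_formalSum {ι σ R : Type*} [CommSemiring R] (w : ι → R) (e : ι → σ →₀ ℕ) (m : σ →₀ ℕ) :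
    MvPowerSeries.coeff m (formalSum w e) = ∑ᶠ (k : ι) (_ : e k = m), w k := rfl

theorem coeff_monomialQSym_monoExp {n : ℕ} (α β : Composition n) (j : Fin α.length ↪o ℕ+) :
    MvPowerSeries.coeff (monoExp α j) (monomialQSym β) = if β = α then 1 else 0 := by
  rw [monomialQSym, coeff_formalSum]
  split_ifs with h
  · subst h
    simp only [(monoExp_injective β).eq_iff]
    rw [finsum_eq_single _ j fun j' hj => by simp [hj]]
    simp
  · have h1 : ∀ j' : Fin β.length ↪o ℕ+, monoExp β j' ≠ monoExp α j := fun j' h' => h (eq_of_monoExp_eq j' j h')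
    simp [h1]

/-- An expansion in monomial quasisymmetric functions is read off from the coefficients. -/
theorem eq_sum_monomialQSym_iff {n : ℕ} (F : MvPowerSeries ℕ+ ℚ[X])
    (hF : ∀ m : ℕ+ →₀ ℕ, m.degree ≠ n → MvPowerSeries.coeff m F = 0) (c : Composition n → ℚ[X])
    (hc : ∀ (α : Composition n) (j : Fin α.length ↪o ℕ+),
      MvPowerSeries.coeff (monoExp α j) F = c α) (b : Composition n → ℚ[X]) :
    F = ∑ α : Composition n, b α • monomialQSym α ↔ ∀ α, b α = c α := by
  have hcoeff : ∀ (α : Composition n) (j : Fin α.length ↪o ℕ+),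
      MvPowerSeries.coeff (monoExp α j) (∑ α : Composition n, b α • monomialQSym α) = b α := by
    intro α j
    rw [map_sum]
    simp only [MvPowerSeries.coeff_smul, coeff_monomialQSym_monoExp, mul_ite, mul_one, mul_zero]
    rw [Finset.sum_ite_eq', if_pos (Finset.mem_univ _)]
  constructor
  · intro h α
    let j : Fin α.length ↪o ℕ+ := OrderEmbedding.ofStrictMono (fun i => Nat.succPNat i)
      fun a b h => Nat.succPNat_strictMono h
    rw [← hc α j, h, hcoeff]
  · intro h
    ext1 m
    by_cases hm : m.degree = n
    · obtain ⟨α, j, rfl⟩ := exists_monoExp_eq m hm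
      rw [hc, hcoeff, h]
    · rw [hF m hm, map_sum]
      refine (Finset.sum_eq_zero fun α _ => ?_).symm
      have h1 : ∀ j : Fin α.length ↪o ℕ+, monoExp α j ≠ m := fun j h' =>
        hm (h' ▸ degree_monoExp α j)
      rw [MvPowerSeries.coeff_smul, monomialQSym, coeff_formalSum]
      simp [h1]

/-! ### Labelings -/

variable {V : Type*} [Fintype V]

-- Composing with a transposition of two labels matches their fibers, so the `n!` labelings split
-- into `n` equal classes.
open Classical in
theorem card_labeling_filter (r : V) (p : Fin (Fintype.card V)) :
    (Finset.univ.filter fun L : Labeling V => L r = p).card =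
      (Fintype.card V - 1).factorial := by
  have hpos : 0 < Fintype.card V := Fintype.card_pos_iff.2 ⟨r⟩
  have heq : ∀ p' : Fin (Fintype.card V), (Finset.univ.filter fun L : Labeling V => L r = p').card =
      (Finset.univ.filter fun L : Labeling V => L r = p).card := by
    intro p'
    refine Finset.card_bij' (fun L _ => L.trans (Equiv.swap p' p))
      (fun L _ => L.trans (Equiv.swap p' p)) ?_ ?_ ?_ ?_
    · intro L hL
      simp only [Finset.mem_filter, Finset.mem_univ, true_and] at hL ⊢
      simp [hL]
    · intro L hL
      simp only [Finset.mem_filter, Finset.mem_univ, true_and] at hL ⊢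
      simp [hL]
    · intro L _
      ext v
      simp
    · intro L _
      ext v
      simp
  have hsum := Finset.card_eq_sum_card_fiberwise (s := (Finset.univ : Finset (Labeling V)))
    (t := Finset.univ) (f := fun L => L r) (fun _ _ => Finset.mem_coe.2 (Finset.mem_univ _))
  rw [Finset.sum_congr rfl fun p' _ => heq p', Finset.sum_const, Finset.card_univ, Finset.card_univ,
    Fintype.card_fin, Fintype.card_equiv (Fintype.equivFin V), smul_eq_mul,
    ← Nat.mul_factorial_pred hpos.ne'] at hsum
  exact (Nat.eq_of_mul_eq_mul_left hpos hsum).symm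

open Classical in
theorem sum_labeling {M : Type*} [AddCommMonoid M] (r : V) (g : Fin (Fintype.card V) → M) :
    ∑ L : Labeling V, g (L r) = (Fintype.card V - 1).factorial • ∑ p, g p := by
  rw [← Finset.sum_fiberwise_of_maps_to (t := Finset.univ) (g := fun L : Labeling V => L r)
    fun _ _ => Finset.mem_univ _, Finset.smul_sum]
  refine Finset.sum_congr rfl fun p _ => ?_
  rw [← card_labeling_filter r p, ← Finset.sum_const]
  exact Finset.sum_congr rfl fun L hL => by rw [(Finset.mem_filter.1 hL).2]

/-! ### Colorings of the star graph -/

/-- Whether an edge from the root, of label `p` and color `i`, to a leaf of label `x` and color `c`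
is an ascent, as an exponent of `q`. -/
def leafWeight {A B : Type*} [LinearOrder A] [LinearOrder B] (p : A) (i : B) (x : A) (c : B) :
    ℚ[X] :=
  if x < p ∧ c < i ∨ p < x ∧ i < c then X else 1

open Classical in
theorem X_pow_asc (r : V) (L : Labeling V) (κ : (SimpleGraph.starGraph r).Coloring ℕ+) :
    (X : ℚ[X]) ^ asc L κ = ∏ v, leafWeight (L r) (κ r) (L v) (κ v) := by
  unfold leafWeight
  rw [Finset.prod_ite, Finset.prod_const, Finset.prod_const_one, mul_one, asc]
  congr 1
  symm
  -- A leaf corresponds to its edge, with the smaller label first. The root has weight `1`, so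
  -- including it in the product is harmless.
  refine Finset.card_bij (fun v _ => if L v < L r then (v, r) else (r, v)) ?_ ?_ ?_
  · intro v hv
    simp only [Finset.mem_filter, Finset.mem_univ, true_and] at hv
    have hne : v ≠ r := by rintro rfl; simp at hv
    simp only [Finset.mem_filter, Finset.mem_univ, true_and, SimpleGraph.starGraph_adj]
    rcases hv with hv | hv
    · rw [if_pos hv.1]
      exact ⟨⟨hne, Or.inr rfl⟩, hv⟩
    · rw [if_neg hv.1.asymm]
      exact ⟨⟨hne.symm, Or.inl rfl⟩, hv⟩
  · intro v _ w _ h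
    split_ifs at h <;> simp only [Prod.mk.injEq] at h <;> aesop
  · rintro ⟨v, w⟩ h
    simp only [Finset.mem_filter, Finset.mem_univ, true_and, SimpleGraph.starGraph_adj] at h
    obtain ⟨⟨-, rfl | rfl⟩, h1, h2⟩ := h
    · exact ⟨w, by simp [h1, h2], by rw [if_neg h1.asymm]⟩
    · exact ⟨v, by simp [h1, h2], by rw [if_pos h1]⟩

open Classical in
theorem card_label_lt (r : V) (L : Labeling V) :
    ((Finset.univ.erase r).filter fun v => L v < L r).card = (L r : ℕ) := by
  rw [← Fin.card_Iio (L r)]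
  refine Finset.card_bij (fun v _ => L v) ?_ (fun _ _ _ _ h => L.injective h) ?_
  · intro v hv
    simpa using (Finset.mem_filter.1 hv).2
  · intro x hx
    have hx : x < L r := by simpa using hx
    refine ⟨L.symm x, ?_, by simp⟩
    simp only [Finset.mem_filter, Finset.mem_erase, Finset.mem_univ, and_true,
      Equiv.apply_symm_apply, hx]
    rintro h
    rw [← h, Equiv.apply_symm_apply] at hx
    exact lt_irrefl _ hx

/-- The maps from `V` to the positions of `α` that take the position `c` exactly `α_c` times, and the
position `i` at the root but not at the leaves: `rootColorings` in terms of positions. -/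
def positionMaps {n : ℕ} (r : V) (α : Composition n) (i : Fin α.length) :
    Set (V → Fin α.length) :=
  {f | (∀ c, ∑ v, (Finsupp.single (f v) 1 : Fin α.length →₀ ℕ) c = α.blocksFun c) ∧ f r = i ∧
    ∀ v, v ≠ r → f v ≠ i}

/-- Ascents only compare colors and `j` is strictly increasing, so colors can be replaced by
positions. The right side does not involve `j`: this is quasisymmetry. -/
theorem finsum_colorings_eq {n : ℕ} (r : V) (L : Labeling V) (α : Composition n)
    (j : Fin α.length ↪o ℕ+) (i : Fin α.length) :
    ∑ᶠ κ ∈ {κ : (SimpleGraph.starGraph r).Coloring ℕ+ | content κ = monoExp α j ∧ κ r = j i},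
        (X : ℚ[X]) ^ asc L κ =
      ∑ᶠ f ∈ positionMaps r α i, ∏ v, leafWeight (L r) i (L v) (f v) := by
  classical
  symm
  have hadj : ∀ f ∈ positionMaps r α i, ∀ {u v : V},
      (SimpleGraph.starGraph r).Adj u v → j (f u) ≠ j (f v) := by
    rintro f ⟨-, hr, hf⟩ u v huv h
    rw [SimpleGraph.starGraph_adj] at huv
    have h := j.injective h
    obtain ⟨hne, rfl | rfl⟩ := huv
    · exact hf v hne.symm (h ▸ hr)
    · exact hf u hne (h ▸ hr)
  have hcontent : ∀ f : V → Fin α.length, ∀ κ : (SimpleGraph.starGraph r).Coloring ℕ+,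
      (∀ v, κ v = j (f v)) → ∀ c, content κ (j c) = ∑ v, (Finsupp.single (f v) 1 : Fin α.length →₀ ℕ) c := by
    intro f κ h c
    simp [content, Finsupp.finsetSum_apply, Finsupp.single_apply, h]
  refine finsum_mem_eq_of_bijOn
    -- The second branch is an arbitrary proper coloring, there only to make the map total.
    (fun f => if hf : f ∈ positionMaps r α i then
      SimpleGraph.Coloring.mk (fun v => j (f v)) (hadj f hf) else
      SimpleGraph.Coloring.mk (fun v => if v = r then 1 else 2) (by
        intro u v huv
        rw [SimpleGraph.starGraph_adj] at huv
        obtain ⟨hne, rfl | rfl⟩ := huv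
        · simp [hne.symm]
        · simp [hne])) ⟨?_, ?_, ?_⟩ ?_
  · intro f hf
    simp only [dif_pos hf]
    refine ⟨?_, congrArg j hf.2.1⟩
    ext c
    by_cases hc : c ∈ Set.range j
    · obtain ⟨c, rfl⟩ := hc
      rw [monoExp_apply, hcontent f _ fun v => rfl]
      exact hf.1 c
    · have h1 : c ∉ (monoExp α j).support := fun h => hc (support_monoExp α j ▸ Finset.mem_coe.2 h)
      rw [Finsupp.notMem_support_iff.1 h1, content_apply, Finset.card_eq_zero,
        Finset.filter_eq_empty_iff]
      rintro v - rfl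
      exact hc ⟨f v, rfl⟩
  · intro f hf g hg h
    simp only [dif_pos hf, dif_pos hg] at h
    funext v
    exact j.injective (DFunLike.congr_fun h v)
  · rintro κ ⟨hκ, hr⟩
    have hrange : ∀ v, ∃ c, j c = κ v := by
      intro v
      have h1 : κ v ∈ (monoExp α j).support := by
        rw [← hκ, Finsupp.mem_support_iff, content_apply, ← Nat.pos_iff_ne_zero, Finset.card_pos]
        exact ⟨v, by simp⟩
      have h2 : κ v ∈ Set.range j := support_monoExp α j ▸ Finset.mem_coe.2 h1
      exact h2
    choose f hf using hrange
    have hmem : f ∈ positionMaps r α i := by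
      refine ⟨fun c => ?_, j.injective (by rw [hf, hr]), fun v hv h => ?_⟩
      · rw [← hcontent f κ (fun v => (hf v).symm), hκ, monoExp_apply]
      · refine κ.valid (SimpleGraph.starGraph_adj.2 ⟨hv, Or.inr rfl⟩) ?_
        rw [← hf v, h, hr]
    refine ⟨f, hmem, ?_⟩
    simp only [dif_pos hmem]
    exact DFunLike.ext _ _ fun v => hf v
  · intro f hf
    simp only [dif_pos hf]
    rw [X_pow_asc]
    refine Finset.prod_congr rfl fun v _ => ?_
    have hv : ∀ v, SimpleGraph.Coloring.mk (fun v => j (f v)) (hadj f hf) v = j (f v) := fun _ => rfl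
    simp only [leafWeight, hv, hf.2.1, j.lt_iff_lt]

theorem positionMaps_eq_empty {n : ℕ} (r : V) (α : Composition n) (i : Fin α.length)
    (hi : α.blocksFun i ≠ 1) : positionMaps r α i = ∅ := by
  classical
  refine Set.eq_empty_of_forall_notMem ?_
  rintro f ⟨h1, h2, h3⟩
  refine hi ?_
  rw [← h1, Finset.sum_eq_single r]
  · simp [h2]
  · intro v _ hv
    exact Finsupp.single_eq_of_ne' (h3 v hv)
  · simp

theorem sizeLeft_add_sizeRight {n : ℕ} (α : Composition n) (i : Fin α.length)
    (hi : α.blocksFun i = 1) : sizeLeft α i + sizeRight α i = n - 1 := by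
  have h1 := α.sum_blocksFun
  have h2 : (Finset.univ : Finset (Fin α.length)) = insert i (Finset.Iio i ∪ Finset.Ioi i) := by
    ext c
    simp [em]
  rw [h2, Finset.sum_insert (by simp), Finset.sum_union (Finset.disjoint_Ioi_Iio i).symm, hi] at h1
  rw [sizeLeft, sizeRight]
  omega

theorem prod_erase_eq_rootGF [DecidableEq V] {n : ℕ} (hn : Fintype.card V = n) (r : V)
    (L : Labeling V) :
    ∏ v ∈ Finset.univ.erase r, (C (if L v < L r then X else 1 : ℚ[X]) * X +
      C (if L v < L r then 1 else X : ℚ[X])) = rootGF (L r) (n - 1 - L r) := by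
  have h1 : ∀ v, C (if L v < L r then X else 1 : ℚ[X]) * X + C (if L v < L r then 1 else X : ℚ[X]) =
      if L v < L r then (1 + C X * X : ℚ[X][X]) else C X + X := by
    intro v
    split_ifs <;> simp [add_comm]
  have h2 : ((Finset.univ.erase r).filter fun v => L v < L r).card = (L r : ℕ) := by
    convert card_label_lt r L
  rw [Finset.prod_congr rfl fun v _ => h1 v, Finset.prod_ite, Finset.prod_const,
    Finset.prod_const, Finset.filter_not, Finset.card_sdiff_of_subset (Finset.filter_subset _ _),
    h2, Finset.card_erase_of_mem (Finset.mem_univ r), Finset.card_univ.trans hn, rootGF]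

/-- The positions in a composition that a coloring with root at position `i` may use at `v`. -/
def allowed [DecidableEq V] {ℓ : ℕ} (r : V) (i : Fin ℓ) (v : V) : Finset (Fin ℓ) :=
  if v = r then {i} else Finset.univ.erase i

theorem sum_leafWeight_root [DecidableEq V] {ℓ : ℕ} (r : V) (L : Labeling V) (i : Fin ℓ) :
    ∑ c ∈ allowed r i r, MvPolynomial.C (leafWeight (L r) i (L r) c) * MvPolynomial.X c =
      MvPolynomial.X i := by
  simp [allowed, leafWeight]

theorem sum_leafWeight [DecidableEq V] {ℓ : ℕ} (r : V) (L : Labeling V) (i : Fin ℓ) (v : V)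
    (hv : v ≠ r) :
    ∑ c ∈ allowed r i v, MvPolynomial.C (leafWeight (L r) i (L v) c) * MvPolynomial.X c =
      algebraMap ℚ[X] (MvPolynomial (Fin ℓ) ℚ[X]) (if L v < L r then X else 1) *
          ∑ c ∈ Finset.Iio i, MvPolynomial.X c +
        algebraMap ℚ[X] (MvPolynomial (Fin ℓ) ℚ[X]) (if L v < L r then 1 else X) *
          ∑ c ∈ Finset.Ioi i, MvPolynomial.X c := by
  have hun : allowed r i v = Finset.Iio i ∪ Finset.Ioi i := by
    ext c
    simp [allowed, hv]
  have hLv : L v ≠ L r := fun h => hv (L.injective h)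
  rw [hun, Finset.sum_union (Finset.disjoint_Ioi_Iio i).symm, MvPolynomial.algebraMap_eq,
    Finset.mul_sum, Finset.mul_sum]
  refine congrArg₂ (· + ·) (Finset.sum_congr rfl fun c hc => ?_)
    (Finset.sum_congr rfl fun c hc => ?_)
  · rw [Finset.mem_Iio] at hc
    have h1 : leafWeight (L r) i (L v) c = if L v < L r then X else 1 := by
      simp [leafWeight, hc, hc.asymm]
    rw [h1]
  · rw [Finset.mem_Ioi] at hc
    have h1 : leafWeight (L r) i (L v) c = if L v < L r then 1 else X := by
      rcases hLv.lt_or_gt with h | h <;> simp [leafWeight, hc, hc.asymm, h, h.asymm]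
    rw [h1]

/-- Expanding the product chooses a position at each vertex; the exponent counts how often each
position is used. -/
theorem finsum_positionMaps_eq_coeff [DecidableEq V] {n : ℕ} (r : V) (L : Labeling V)
    (α : Composition n) (i : Fin α.length) (m : Fin α.length →₀ ℕ)
    (hm : ∀ c, m c = α.blocksFun c) :
    ∑ᶠ f ∈ positionMaps r α i, ∏ v, leafWeight (L r) i (L v) (f v) =
      MvPolynomial.coeff m (∏ v, ∑ c ∈ allowed r i v,
        MvPolynomial.C (leafWeight (L r) i (L v) c) * MvPolynomial.X c) := by
  rw [Finset.prod_univ_sum, MvPolynomial.coeff_sum]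
  have hterm : ∀ f : V → Fin α.length, MvPolynomial.coeff m
      (∏ v, MvPolynomial.C (leafWeight (L r) i (L v) (f v)) * MvPolynomial.X (f v)) =
      if ∑ v, Finsupp.single (f v) 1 = m then ∏ v, leafWeight (L r) i (L v) (f v) else 0 := by
    intro f
    have h1 : ∏ v, (MvPolynomial.X (f v) : MvPolynomial (Fin α.length) ℚ[X]) =
        MvPolynomial.monomial (∑ v, Finsupp.single (f v) 1) 1 :=
      (MvPolynomial.monomial_sum_one _ _).symm
    rw [Finset.prod_mul_distrib, ← map_prod, h1, MvPolynomial.coeff_C_mul,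
      MvPolynomial.coeff_monomial, mul_ite, mul_one, mul_zero]
  rw [Finset.sum_congr rfl fun f _ => hterm f, ← Finset.sum_filter, ← finsum_mem_coe_finset]
  refine finsum_mem_congr ?_ fun _ _ => rfl
  ext f
  simp only [positionMaps, Set.mem_ofPred_eq, Finset.coe_filter, Fintype.mem_piFinset]
  have h1 : (∀ v, f v ∈ allowed r i v) ↔ f r = i ∧ ∀ v, v ≠ r → f v ≠ i := by
    constructor
    · intro h
      exact ⟨by simpa [allowed] using h r, fun v hv => by simpa [allowed, hv] using h v⟩
    · rintro ⟨h1, h2⟩ v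
      by_cases hv : v = r
      · simp [allowed, hv, h1]
      · simp [allowed, hv, h2 v hv]
  have h2 : (∑ v, Finsupp.single (f v) 1 = m) ↔
      ∀ c, ∑ v, (Finsupp.single (f v) 1 : Fin α.length →₀ ℕ) c = α.blocksFun c := by
    simp only [DFunLike.ext_iff, Finsupp.finsetSum_apply, hm]
  rw [h1, h2]
  exact and_comm

theorem finsum_positionMaps {n : ℕ} (hn : Fintype.card V = n) (r : V) (L : Labeling V)
    (α : Composition n) (i : Fin α.length) (hi : α.blocksFun i = 1) :
    ∑ᶠ f ∈ positionMaps r α i, ∏ v, leafWeight (L r) i (L v) (f v) =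
      ((multRight α i * multLeft α i : ℕ) : ℚ[X]) *
        (rootGF (L r) (n - 1 - L r)).coeff (sizeLeft α i) := by
  classical
  let m : Fin α.length →₀ ℕ := Finsupp.equivFunOnFinite.symm α.blocksFun
  have hcard : (Finset.univ.erase r).card = n - 1 := by
    rw [Finset.card_erase_of_mem (Finset.mem_univ r), Finset.card_univ, hn]
  have hsize := sizeLeft_add_sizeRight α i hi
  rw [finsum_positionMaps_eq_coeff r L α i m fun c => rfl,
    ← Finset.mul_prod_erase _ _ (Finset.mem_univ r), sum_leafWeight_root,
    Finset.prod_congr rfl fun v hv => sum_leafWeight r L i v (Finset.ne_of_mem_erase hv),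
    prod_linear_eq_sum, prod_erase_eq_rootGF hn, hcard, Finset.mul_sum, MvPolynomial.coeff_sum]
  -- Only `k = sizeLeft α i` survives; the condition on the right side is then automatic, as the two
  -- sizes sum to `n - 1`.
  have hterm : ∀ k, MvPolynomial.coeff m (MvPolynomial.X i *
      (algebraMap ℚ[X] (MvPolynomial (Fin α.length) ℚ[X]) ((rootGF (L r) (n - 1 - L r)).coeff k) *
        ((∑ c ∈ Finset.Iio i, MvPolynomial.X c) ^ k *
          (∑ c ∈ Finset.Ioi i, MvPolynomial.X c) ^ (n - 1 - k)))) =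
      if sizeLeft α i = k then ((multRight α i * multLeft α i : ℕ) : ℚ[X]) *
        (rootGF (L r) (n - 1 - L r)).coeff k else 0 := by
    intro k
    rw [mul_left_comm, MvPolynomial.algebraMap_eq, MvPolynomial.coeff_C_mul,
      coeff_sum_X_pow_mul _ _ _ (by simp) (by simp) (Finset.disjoint_Ioi_Iio i).symm m hi
        (fun c h1 h2 h3 => by
          rw [Finset.mem_Iio] at h2
          rw [Finset.mem_Ioi] at h3
          exact absurd (le_antisymm (not_lt.1 h3) (not_lt.1 h2)) h1)]
    have hiff : (∑ c ∈ Finset.Iio i, m c = k ∧ ∑ c ∈ Finset.Ioi i, m c = n - 1 - k) ↔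
        sizeLeft α i = k := by
      change (sizeLeft α i = k ∧ sizeRight α i = n - 1 - k) ↔ sizeLeft α i = k
      omega
    rw [if_congr hiff rfl rfl, mul_ite, mul_zero, mul_comm]
    rfl
  rw [Finset.sum_congr rfl fun k _ => hterm k, Finset.sum_ite_eq, if_pos]
  rw [Finset.mem_range]
  omega

theorem finsum_colorings_of_eq_one {n : ℕ} (hn : Fintype.card V = n) (r : V) (L : Labeling V)
    (α : Composition n) (j : Fin α.length ↪o ℕ+) (i : Fin α.length) (hi : α.blocksFun i = 1) :
    ∑ᶠ κ ∈ {κ : (SimpleGraph.starGraph r).Coloring ℕ+ | content κ = monoExp α j ∧ κ r = j i},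
        (X : ℚ[X]) ^ asc L κ =
      ((multRight α i * multLeft α i : ℕ) : ℚ[X]) *
        (rootGF (L r) (n - 1 - L r)).coeff (sizeLeft α i) := by
  rw [finsum_colorings_eq, finsum_positionMaps hn r L α i hi]

/-! ### Summation over root positions and labelings. -/

theorem sum_coeff_rootGF {n : ℕ} (hn : Fintype.card V = n) (r : V) (a : ℕ) :
    ∑ p : Fin (Fintype.card V), (rootGF p (n - 1 - p)).coeff a = (starGF (n - 1)).coeff a := by
  have hpos : 0 < Fintype.card V := Fintype.card_pos_iff.2 ⟨r⟩
  rw [starGF, finsetSum_coeff, Nat.sub_add_cancel (by omega), ← hn,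
    Fin.sum_univ_eq_sum_range fun p => (rootGF p (Fintype.card V - 1 - p)).coeff a]

theorem coeff_cqsf_starGraph {n : ℕ} (hn : Fintype.card V = n) (r : V) (L : Labeling V)
    (α : Composition n) (j : Fin α.length ↪o ℕ+) :
    MvPowerSeries.coeff (monoExp α j) (cqsf (SimpleGraph.starGraph r) L) =
      ∑ i ∈ Finset.univ.filter (fun i : Fin α.length => α.blocksFun i = 1),
        ((multRight α i * multLeft α i : ℕ) : ℚ[X]) *
          (rootGF (L r) (n - 1 - L r)).coeff (sizeLeft α i) := by
  classical
  have hunion : {κ : (SimpleGraph.starGraph r).Coloring ℕ+ | content κ = monoExp α j} =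
      ⋃ i, {κ | content κ = monoExp α j ∧ κ r = j i} := by
    ext κ
    simp only [Set.mem_ofPred_eq, Set.mem_iUnion, exists_and_left]
    refine ⟨fun h => ⟨h, ?_⟩, fun h => h.1⟩
    have h1 : κ r ∈ (monoExp α j).support := by
      rw [← h, Finsupp.mem_support_iff, content_apply, ← Nat.pos_iff_ne_zero, Finset.card_pos]
      exact ⟨r, by simp⟩
    have h2 : κ r ∈ Set.range j := support_monoExp α j ▸ Finset.mem_coe.2 h1
    obtain ⟨i, hi⟩ := h2
    exact ⟨i, hi.symm⟩
  have h : MvPowerSeries.coeff (monoExp α j) (cqsf (SimpleGraph.starGraph r) L) =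
      ∑ᶠ κ ∈ {κ : (SimpleGraph.starGraph r).Coloring ℕ+ | content κ = monoExp α j},
        (X : ℚ[X]) ^ asc L κ := rfl
  rw [h, hunion, finsum_mem_iUnion, finsum_eq_sum_of_fintype, Finset.sum_filter]
  · refine Finset.sum_congr rfl fun i _ => ?_
    split_ifs with hi
    · exact finsum_colorings_of_eq_one hn r L α j i hi
    · rw [finsum_colorings_eq, positionMaps_eq_empty r α i hi, finsum_mem_empty]
  · intro i i' hii
    rw [Function.onFun, Set.disjoint_left]
    rintro κ ⟨-, h1⟩ ⟨-, h2⟩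
    exact hii (j.injective (h1.symm.trans h2))
  · exact fun i => (finite_coloring_fiber _ _).subset fun κ h => h.1

theorem coeff_normalizedStar {n : ℕ} (hn : Fintype.card V = n) (r : V)
    (α : Composition n) (j : Fin α.length ↪o ℕ+) :
    MvPowerSeries.coeff (monoExp α j) (normalizedStar r) =
      ∑ i ∈ Finset.univ.filter (fun i : Fin α.length => α.blocksFun i = 1),
        ((multRight α i * multLeft α i : ℕ) : ℚ[X]) * (starGF (n - 1)).coeff (sizeLeft α i) := by
  have hsmul : ∀ (c : ℚ) (F : MvPowerSeries ℕ+ ℚ[X]),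
      MvPowerSeries.coeff (monoExp α j) (c • F) = c • MvPowerSeries.coeff (monoExp α j) F :=
    fun _ _ => rfl
  rw [normalizedStar, hsmul, totalCqsf, map_sum,
    Finset.sum_congr rfl fun L _ => coeff_cqsf_starGraph hn r L α j,
    sum_labeling r fun p => ∑ i ∈ Finset.univ.filter (fun i : Fin α.length => α.blocksFun i = 1),
        ((multRight α i * multLeft α i : ℕ) : ℚ[X]) *
          (rootGF p (n - 1 - p)).coeff (sizeLeft α i),
    ← Nat.cast_smul_eq_nsmul ℚ, inv_smul_smul₀ (Nat.cast_ne_zero.2 (Nat.factorial_ne_zero _)),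
    Finset.sum_comm]
  refine Finset.sum_congr rfl fun i _ => ?_
  rw [← Finset.mul_sum, sum_coeff_rootGF hn r]

theorem coeff_normalizedStar_of_degree_ne (r : V) (m : ℕ+ →₀ ℕ) (hm : m.degree ≠ Fintype.card V) :
    MvPowerSeries.coeff m (normalizedStar r) = 0 := by
  have hsmul : ∀ (c : ℚ) (F : MvPowerSeries ℕ+ ℚ[X]),
      MvPowerSeries.coeff m (c • F) = c • MvPowerSeries.coeff m F := fun _ _ => rfl
  have h : ∀ κ : (SimpleGraph.starGraph r).Coloring ℕ+, content κ ≠ m :=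
    fun κ h => hm (h ▸ degree_content κ)
  rw [normalizedStar, hsmul, totalCqsf, map_sum, Finset.sum_eq_zero, smul_zero]
  intro L _
  rw [cqsf, coeff_formalSum]
  simp [h]

end StarCQSF

end

theorem mainTheorem1 {V : Type*} [Fintype V] (r : V) (n : ℕ) (hn : Fintype.card V = n) :
    (∀ b : Composition n → Polynomial ℚ,
      StarCQSF.normalizedStar r = ∑ α : Composition n, b α • StarCQSF.monomialQSym α ↔
        ∀ α : Composition n, b α =
          ∑ i ∈ Finset.univ.filter (fun i : Fin α.length => α.blocksFun i = 1),
            ((StarCQSF.multRight α i * StarCQSF.multLeft α i : ℕ) : Polynomial ℚ) *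
              ∑ l ∈ Finset.range (min (StarCQSF.sizeRight α i) (StarCQSF.sizeLeft α i) + 1),
                (Nat.choose n l : Polynomial ℚ) * Polynomial.X ^ l * StarCQSF.qInt (n - 2 * l)) ∧
    (∀ Lr : Fin (Fintype.card V) → StarCQSF.Labeling V, (∀ k, Lr k r = k) →
      ∀ (α : Composition n) (i : Fin α.length), α.blocksFun i = 1 → ∀ k : ℕ, k ≤ n - 1 →
        (StarCQSF.rootCoeff r Lr α i).coeff k =
          ((StarCQSF.multRight α i * StarCQSF.multLeft α i : ℕ) : ℚ) *
            ∑ l ∈ Finset.range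
                (min (min k (n - 1 - k)) (min (StarCQSF.sizeRight α i) (StarCQSF.sizeLeft α i)) + 1),
              (Nat.choose n l : ℚ)) := by
  have hpos : 0 < n := hn ▸ Fintype.card_pos_iff.2 ⟨r⟩
  constructor
  · refine StarCQSF.eq_sum_monomialQSym_iff _
      (fun m hm => StarCQSF.coeff_normalizedStar_of_degree_ne r m (hn ▸ hm)) _ fun α j => ?_
    rw [StarCQSF.coeff_normalizedStar hn r α j]
    refine Finset.sum_congr rfl fun i hi => ?_
    rw [StarCQSF.coeff_starGF _ _ _
      (StarCQSF.sizeLeft_add_sizeRight α i (Finset.mem_filter.1 hi).2), Nat.sub_add_cancel hpos]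
  · intro Lr hLr α i hi k hk
    have hsize := StarCQSF.sizeLeft_add_sizeRight α i hi
    have h : ∀ p, ∑ᶠ κ ∈ StarCQSF.rootColorings r α i, (X : ℚ[X]) ^ StarCQSF.asc (Lr p) κ =
        ((StarCQSF.multRight α i * StarCQSF.multLeft α i : ℕ) : ℚ[X]) *
          (StarCQSF.rootGF p (n - 1 - p)).coeff (StarCQSF.sizeLeft α i) := by
      intro p
      have h1 := StarCQSF.finsum_colorings_of_eq_one hn r (Lr p) α
        (OrderEmbedding.ofStrictMono (fun i : Fin α.length => Nat.succPNat i)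
          fun a b h => Nat.succPNat_strictMono h) i hi
      rw [hLr] at h1
      exact h1
    rw [StarCQSF.rootCoeff, Finset.sum_congr rfl fun p _ => h p, ← Finset.mul_sum,
      StarCQSF.sum_coeff_rootGF hn r, coeff_natCast_mul, StarCQSF.coeff_coeff_starGF,
      StarCQSF.chooseSum, Nat.sub_add_cancel hpos, Nat.cast_sum]
    congr 3
    -- Here `n - sizeLeft α i = sizeRight α i + 1`, and `k ≤ n - 1` gives `n - k = (n - 1 - k) + 1`;
    -- for larger `k` truncation would leave a spurious term `l = 0`.
    rw [StarCQSF.starBound]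
    omega
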